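/- Let $(N,\tilde g)$ be a $4$-dimensional time-oriented Lorentzian manifold of signature $(-,+,+,+)$ with Levi-Civita connection $\tilde\nabla$, and let $M\subset N$ be a connected, smoothly embedded spacelike $3$-dimensional hypersurface with boundary (an initial data set) whose boundary $\Sigma$ has finitely many connected components $\Sigma_1,\dots,\Sigma_l$, each of them a topological $2$-sphere. Let $\mathbb S$ be the hypersurface spinor bundle of $M$, i.e. the restriction to $M$ of the (complex rank $4$) Dirac spinor bundle associated with a spin structure of $N$ near $M$, with Clifford multiplication normalised by $X\cdot X=-\tilde g(X,X)$, and denote also by $\tilde\nabla$ the lift of the Levi-Civita connection of $\tilde g$ to $\mathbb S$. Let $e_0$ be the future-directed unit normal of $M$, let $e_r$ be the outward unit normal of $\Sigma$ in $M$, and let $P_\pm=\frac12(\mathrm{Id}\pm e_0\cdot e_r\cdot)$ on $\mathbb S|_\Sigma$. Let $\phi,\psi$ be smooth sections of $\mathbb S$ over $M$ with $\tilde\nabla_X\phi=\tilde\nabla_X\psi=0$ for all vectors $X$ tangent to $M$. Suppose that for some $i$ the sections $P_+\phi|_{\Sigma_i}$, $P_+\psi|_{\Sigma_i}$ over $\Sigma_i$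 are linearly independent over $\mathbb C$, or that the sections $P_-\phi|_{\Sigma_i}$, $P_-\psi|_{\Sigma_i}$ are linearly independent over $\mathbb C$. Then $\phi$ and $\psi$ are linearly independent at every point of $M$: for each $x\in M$ the vectors $\phi(x),\psi(x)\in\mathbb S_x$ are linearly independent over $\mathbb C$. -/

import Mathlib

open Set
open scoped Manifold ContDiff Matrix

noncomputable section

namespace HypersurfaceSpinor

/-! ### Clifford algebra, Dirac matrices and the spin representation -/

/-- The signs `(-1, 1, 1, 1)` of a Lorentzian orthonormal frame `e₀, e₁, e₂, e₃`. -/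
def eps : Fin 4 → ℝ := ![-1, 1, 1, 1]

/-- The quadratic form `v ↦ v₀² - v₁² - v₂² - v₃²`. Clifford multiplication is normalised by
`v · v = - g(v, v)`, so that `e₀ · e₀ = 1` and `eᵢ · eᵢ = -1`. -/
def cliffordForm : QuadraticForm ℝ (Fin 4 → ℝ) :=
  QuadraticMap.weightedSumSquares ℝ (fun α => -eps α)

/-- The Dirac matrices. -/
def gamma : Fin 4 → Matrix (Fin 4) (Fin 4) ℂ :=
  ![!![1, 0, 0, 0; 0, 1, 0, 0; 0, 0, -1, 0; 0, 0, 0, -1],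
    !![0, 0, 0, 1; 0, 0, 1, 0; 0, -1, 0, 0; -1, 0, 0, 0],
    !![0, 0, 0, -Complex.I; 0, 0, Complex.I, 0; 0, Complex.I, 0, 0; -Complex.I, 0, 0, 0],
    !![0, 0, 1, 0; 0, 0, 0, -1; -1, 0, 0, 0; 0, 1, 0, 0]]

/-- Clifford multiplication by the vector with coordinates `v`, on the model spinor space `ℂ⁴`. -/
def gammaVec : (Fin 4 → ℝ) →ₗ[ℝ] Matrix (Fin 4) (Fin 4) ℂ :=
  Fintype.linearCombination ℝ gamma

theorem gammaVec_mul_self (v : Fin 4 → ℝ) :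
    gammaVec v * gammaVec v = algebraMap ℝ (Matrix (Fin 4) (Fin 4) ℂ) (cliffordForm v) := by
  have hI : Complex.I * Complex.I = -1 := Complex.I_mul_I
  ext i j
  simp only [gammaVec, Fintype.linearCombination_apply, Fin.sum_univ_four, Matrix.mul_apply,
    Matrix.add_apply, Matrix.smul_apply, Matrix.algebraMap_matrix_apply, cliffordForm,
    QuadraticMap.weightedSumSquares_apply, eps, Complex.real_smul, smul_eq_mul]
  fin_cases i <;> fin_cases j <;> simp [gamma] <;> first | ring1 | skip
  all_goals linear_combination ((v 2 : ℂ) ^ 2) * hI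

/-- The complex spin representation, on the whole (real) Clifford algebra. -/
def spinRep : CliffordAlgebra cliffordForm →ₐ[ℝ] Matrix (Fin 4) (Fin 4) ℂ :=
  CliffordAlgebra.lift cliffordForm ⟨gammaVec, gammaVec_mul_self⟩

theorem spinRep_ι (v : Fin 4 → ℝ) :
    spinRep (CliffordAlgebra.ι cliffordForm v) = gammaVec v := by
  simp [spinRep]

/-! ### Spacetimes -/

section Spacetime

/-- A time-oriented Lorentzian metric of signature `(-, +, +, +)` on a `4`-manifold. -/
structure Spacetime (N : Type*) [TopologicalSpace N] [ChartedSpace (EuclideanSpace ℝ (Fin 4)) N]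
    [IsManifold (𝓡 4) ∞ N] where
  /-- the metric -/
  metric (y : N) : TangentSpace (𝓡 4) y →L[ℝ] TangentSpace (𝓡 4) y →L[ℝ] ℝ
  symm (y : N) (v w : TangentSpace (𝓡 4) y) : metric y v w = metric y w v
  lorentzian (y : N) : ∃ e : Fin 4 → TangentSpace (𝓡 4) y,
    ∀ α β, metric y (e α) (e β) = if α = β then eps α else 0
  contMDiff_metric : ContMDiff (𝓡 4)
    ((𝓡 4).prod 𝓘(ℝ, EuclideanSpace ℝ (Fin 4) →L[ℝ] EuclideanSpace ℝ (Fin 4) →L[ℝ] ℝ)) ∞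
    (fun y => Bundle.TotalSpace.mk'
      (EuclideanSpace ℝ (Fin 4) →L[ℝ] EuclideanSpace ℝ (Fin 4) →L[ℝ] ℝ) y (metric y))
  /-- a continuous timelike vector field, which gives the time orientation -/
  timeField (y : N) : TangentSpace (𝓡 4) y
  continuous_timeField : Continuous (fun y =>
    (Bundle.TotalSpace.mk' (EuclideanSpace ℝ (Fin 4)) y (timeField y) : TangentBundle (𝓡 4) N))
  timelike_timeField (y : N) : metric y (timeField y) (timeField y) < 0

variable {N : Type*} [TopologicalSpace N] [ChartedSpace (EuclideanSpace ℝ (Fin 4)) N]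
  [IsManifold (𝓡 4) ∞ N]

/-- Future-directed timelike vectors. -/
def Spacetime.IsFuture (g : Spacetime N) {y : N} (v : TangentSpace (𝓡 4) y) : Prop :=
  g.metric y v v < 0 ∧ g.metric y (g.timeField y) v < 0

/-- Connections on the tangent bundle of `N`. -/
abbrev Connection (N : Type*) [TopologicalSpace N] [ChartedSpace (EuclideanSpace ℝ (Fin 4)) N]
    [IsManifold (𝓡 4) ∞ N] :=
  CovariantDerivative (𝓡 4) (EuclideanSpace ℝ (Fin 4)) (fun y : N => TangentSpace (𝓡 4) y)

/-- `D` is the Levi-Civita connection of the spacetime metric: torsion-free and metric.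
In Mathlib's argument order `D Y y v` is `(∇̃_v Y)(y)`. -/
structure Spacetime.IsLeviCivita (g : Spacetime N) (D : Connection N) : Prop where
  torsion_free : D.torsion = 0
  metric : ∀ (y : N) (Y Z : ∀ z : N, TangentSpace (𝓡 4) z),
    MDifferentiableAt (𝓡 4) ((𝓡 4).prod 𝓘(ℝ, EuclideanSpace ℝ (Fin 4)))
      (fun z => Bundle.TotalSpace.mk' (EuclideanSpace ℝ (Fin 4)) z (Y z)) y →
    MDifferentiableAt (𝓡 4) ((𝓡 4).prod 𝓘(ℝ, EuclideanSpace ℝ (Fin 4)))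
      (fun z => Bundle.TotalSpace.mk' (EuclideanSpace ℝ (Fin 4)) z (Z z)) y →
    ∀ v : TangentSpace (𝓡 4) y,
      mfderiv (𝓡 4) 𝓘(ℝ, ℝ) (fun z => g.metric z (Y z) (Z z)) y v =
        g.metric y (D Y y v) (Z y) + g.metric y (Y y) (D Z y v)

end Spacetime

/-! ### Spin structures, spinors and the spin connection -/

section Spin

variable {N : Type*} [TopologicalSpace N] [ChartedSpace (EuclideanSpace ℝ (Fin 4)) N]
  [IsManifold (𝓡 4) ∞ N]

/-- Coordinates `v^α = ε_α g(e_α, v)` of the tangent vector `v` in the orthonormal frame `e`. -/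
def frameCoord (g : Spacetime N) {y : N} (e : Fin 4 → TangentSpace (𝓡 4) y)
    (v : TangentSpace (𝓡 4) y) : Fin 4 → ℝ :=
  fun α => eps α * g.metric y (e α) v

/-- A spin structure on a neighbourhood of a set `K` of the spacetime: an open cover of `K`,
smooth orthonormal frames with future-directed `e₀` on its members, and, on overlaps, smooth lifts
to the spin group of the changes of frame, which satisfy the cocycle condition. -/
structure SpinStructure (g : Spacetime N) (K : Set N) where
  /-- labels of the local frames -/
  Idx : Type*
  /-- the domain of a local frame -/
  dom : Idx → Set N
  isOpen_dom : ∀ i, IsOpen (dom i)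
  covers : K ⊆ ⋃ i, dom i
  /-- the local orthonormal frames `e₀, e₁, e₂, e₃`; only their values on the domain matter -/
  frame : Idx → Fin 4 → ∀ y : N, TangentSpace (𝓡 4) y
  contMDiffOn_frame : ∀ i α, ContMDiffOn (𝓡 4) ((𝓡 4).prod 𝓘(ℝ, EuclideanSpace ℝ (Fin 4))) ∞
    (fun y => Bundle.TotalSpace.mk' (EuclideanSpace ℝ (Fin 4)) y (frame i α y)) (dom i)
  orthonormal : ∀ i, ∀ y ∈ dom i, ∀ α β,
    g.metric y (frame i α y) (frame i β y) = if α = β then eps α else 0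
  future : ∀ i, ∀ y ∈ dom i, g.IsFuture (frame i 0 y)
  /-- lifts of the changes of frame -/
  trans : Idx → Idx → N → spinGroup cliffordForm
  contMDiffOn_trans : ∀ i j a b, ContMDiffOn (𝓡 4) 𝓘(ℝ, ℂ) ∞
    (fun y => spinRep (trans i j y : CliffordAlgebra cliffordForm) a b) (dom i ∩ dom j)
  cocycle : ∀ i j k, ∀ y ∈ dom i ∩ dom j ∩ dom k, trans i j y * trans j k y = trans i k y
  lifts : ∀ i j, ∀ y ∈ dom i ∩ dom j, ∀ v : TangentSpace (𝓡 4) y,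
    (trans i j y : CliffordAlgebra cliffordForm) *
        CliffordAlgebra.ι cliffordForm (frameCoord g (fun α => frame j α y) v) =
      CliffordAlgebra.ι cliffordForm (frameCoord g (fun α => frame i α y) v) *
        (trans i j y : CliffordAlgebra cliffordForm)

namespace SpinStructure

variable {g : Spacetime N} {K : Set N} (S : SpinStructure g K)

/-- The fibre at `y` of the spinor bundle, i.e. of the complex vector bundle associated with the
spin structure by the spin representation: a spinor at `y` has a component in `ℂ⁴` with respect to
each local frame around `y`, and these are related by the spin representation. -/
def fiber (y : N) : Submodule ℂ ({i : S.Idx // y ∈ S.dom i} → Fin 4 → ℂ) where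
  carrier := {s | ∀ i j, s i = spinRep (S.trans i.1 j.1 y) *ᵥ s j}
  zero_mem' := by intro i j; simp
  add_mem' := by
    intro s t hs ht i j
    rw [Pi.add_apply, Pi.add_apply, hs i j, ht i j, Matrix.mulVec_add]
  smul_mem' := by
    intro c s hs i j
    rw [Pi.smul_apply, Pi.smul_apply, hs i j, Matrix.mulVec_smul]

/-- Clifford multiplication `s ↦ v · s` by a tangent vector `v` of the spacetime. -/
def cliff {y : N} (v : TangentSpace (𝓡 4) y) : S.fiber y →ₗ[ℂ] S.fiber y where
  toFun s := ⟨fun i => gammaVec (frameCoord g (fun α => S.frame i.1 α y) v) *ᵥ s.1 i, by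
    intro i j
    have h := congrArg spinRep (S.lifts i.1 j.1 y ⟨i.2, j.2⟩ v)
    rw [map_mul, map_mul, spinRep_ι, spinRep_ι] at h
    beta_reduce
    rw [s.2 i j, Matrix.mulVec_mulVec, Matrix.mulVec_mulVec, h]⟩
  map_add' s t := Subtype.ext (funext fun i => Matrix.mulVec_add _ (s.1 i) (t.1 i))
  map_smul' c s := Subtype.ext (funext fun i => Matrix.mulVec_smul _ c (s.1 i))

/-- The matrix `¼ ∑ ε_α ε_β g(∇̃_v e_α, e_β) γ_α γ_β` of the spin connection in a local frame. -/
def connMatrix (D : Connection N) (i : S.Idx) {y : N} (v : TangentSpace (𝓡 4) y) :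
    Matrix (Fin 4) (Fin 4) ℂ :=
  (1 / 4 : ℝ) • ∑ α, ∑ β,
    (eps α * eps β * g.metric y (D (S.frame i α) y v) (S.frame i β y)) • (gamma α * gamma β)

end SpinStructure

end Spin

/-! ### Spacelike hypersurfaces with boundary -/

section Hypersurface

variable {N : Type*} [TopologicalSpace N] [ChartedSpace (EuclideanSpace ℝ (Fin 4)) N]
  [IsManifold (𝓡 4) ∞ N]

/-- A smooth embedding of the `3`-manifold with boundary `M` into the spacetime as a spacelike
hypersurface. -/
structure SpacelikeHypersurface (g : Spacetime N) (M : Type*) [TopologicalSpace M]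
    [ChartedSpace (EuclideanHalfSpace 3) M] [IsManifold (𝓡∂ 3) ∞ M] where
  /-- the inclusion of `M` in the spacetime -/
  emb : M → N
  contMDiff_emb : ContMDiff (𝓡∂ 3) (𝓡 4) ∞ emb
  isEmbedding : Topology.IsEmbedding emb
  spacelike : ∀ (x : M) (X : TangentSpace (𝓡∂ 3) x), X ≠ 0 →
    0 < g.metric (emb x) (mfderiv (𝓡∂ 3) (𝓡 4) emb x X) (mfderiv (𝓡∂ 3) (𝓡 4) emb x X)

variable {M : Type*} [TopologicalSpace M] [ChartedSpace (EuclideanHalfSpace 3) M]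
  [IsManifold (𝓡∂ 3) ∞ M]

/-- The sets `B 0, …, B (l - 1)` are the connected components of the boundary of `M`, and each of
them is a topological `2`-sphere. -/
structure AreBoundarySpheres {l : ℕ} (B : Fin l → Set M) : Prop where
  injective : Function.Injective B
  isComponent : ∀ k, ∃ x ∈ (𝓡∂ 3).boundary M, B k = connectedComponentIn ((𝓡∂ 3).boundary M) x
  covers : (𝓡∂ 3).boundary M ⊆ ⋃ k, B k
  sphere : ∀ k, Nonempty (B k ≃ₜ Metric.sphere (0 : EuclideanSpace ℝ (Fin 3)) 1)

/-- For a boundary point `x`, the derivative at `x` of the coordinate `x₀ ≥ 0` of the preferred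
chart, which vanishes on the boundary: the vector `X` is tangent to the boundary when the value is
`0`, and points outwards when it is negative. -/
def inwardCoord (x : M) (X : TangentSpace (𝓡∂ 3) x) : ℝ :=
  (show EuclideanSpace ℝ (Fin 3) from
    mfderiv (𝓡∂ 3) 𝓘(ℝ, EuclideanSpace ℝ (Fin 3)) (extChartAt (𝓡∂ 3) x) x X) 0

namespace SpacelikeHypersurface

variable {g : Spacetime N} (F : SpacelikeHypersurface g M)

/-- The vector of the spacetime given by a vector tangent to `M`. -/
def push {x : M} (X : TangentSpace (𝓡∂ 3) x) : TangentSpace (𝓡 4) (F.emb x) :=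
  mfderiv (𝓡∂ 3) (𝓡 4) F.emb x X

/-- `n` is the future-directed unit normal `e₀` to `M` at `x`. -/
structure IsFutureUnitNormal (x : M) (n : TangentSpace (𝓡 4) (F.emb x)) : Prop where
  unit : g.metric (F.emb x) n n = -1
  normal : ∀ X : TangentSpace (𝓡∂ 3) x, g.metric (F.emb x) n (F.push X) = 0
  future : g.IsFuture n

/-- `r` is the unit vector `e_r` tangent to `M`, orthogonal to the boundary at the boundary point
`x` and pointing out of `M`. -/
structure IsOutwardUnitNormal (x : M) (r : TangentSpace (𝓡∂ 3) x) : Prop where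
  unit : g.metric (F.emb x) (F.push r) (F.push r) = 1
  normal : ∀ X : TangentSpace (𝓡∂ 3) x, inwardCoord x X = 0 →
    g.metric (F.emb x) (F.push r) (F.push X) = 0
  outward : inwardCoord x r < 0

/-- Spinor fields: sections over `M` of the spinor bundle of the spacetime, i.e. of the
hypersurface spinor bundle. -/
abbrev SpinorField (S : SpinStructure g (range F.emb)) :=
  ∀ x : M, S.fiber (F.emb x)

variable {S : SpinStructure g (range F.emb)}

open Classical in
/-- The component of a spinor field in a local frame (`0` outside of the domain of the frame). -/
def component (φ : F.SpinorField S) (i : S.Idx) (x : M) : Fin 4 → ℂ :=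
  if h : F.emb x ∈ S.dom i then (φ x).1 ⟨i, h⟩ else 0

/-- Smooth spinor fields. -/
def IsSmooth (φ : F.SpinorField S) : Prop :=
  ∀ i, ContMDiffOn (𝓡∂ 3) 𝓘(ℝ, Fin 4 → ℂ) ∞ (F.component φ i) (F.emb ⁻¹' S.dom i)

/-- The component in a local frame of the covariant derivative `∇̃_X φ`, where `X` is tangent to
`M` and `∇̃` is the lift of the connection `D` to the spinor bundle. -/
def spinDeriv (D : Connection N) (φ : F.SpinorField S) (i : S.Idx) (x : M)
    (X : TangentSpace (𝓡∂ 3) x) : Fin 4 → ℂ :=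
  (show Fin 4 → ℂ from mfderiv (𝓡∂ 3) 𝓘(ℝ, Fin 4 → ℂ) (F.component φ i) x X) +
    S.connMatrix D i (F.push X) *ᵥ F.component φ i x

/-- `∇̃_X φ = 0` for all vectors `X` tangent to `M`. -/
def IsParallel (D : Connection N) (φ : F.SpinorField S) : Prop :=
  ∀ (x : M) (i : S.Idx), F.emb x ∈ S.dom i → ∀ X : TangentSpace (𝓡∂ 3) x,
    F.spinDeriv D φ i x X = 0

variable (S) in
/-- `P₊ = ½ (Id + e₀ · e_r ·)`. -/
def projPlus {x : M} (n : TangentSpace (𝓡 4) (F.emb x)) (r : TangentSpace (𝓡∂ 3) x) :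
    S.fiber (F.emb x) →ₗ[ℂ] S.fiber (F.emb x) :=
  (1 / 2 : ℂ) • (LinearMap.id + S.cliff n ∘ₗ S.cliff (F.push r))

variable (S) in
/-- `P₋ = ½ (Id - e₀ · e_r ·)`. -/
def projMinus {x : M} (n : TangentSpace (𝓡 4) (F.emb x)) (r : TangentSpace (𝓡∂ 3) x) :
    S.fiber (F.emb x) →ₗ[ℂ] S.fiber (F.emb x) :=
  (1 / 2 : ℂ) • (LinearMap.id - S.cliff n ∘ₗ S.cliff (F.push r))

end SpacelikeHypersurface

end Hypersurface

end HypersurfaceSpinor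

end

namespace HypersurfaceSpinor

/-! ### Lorentzian frames and the smoothness of metric pairings -/

section Frames

variable {N : Type*} [TopologicalSpace N] [ChartedSpace (EuclideanSpace ℝ (Fin 4)) N]
  [IsManifold (𝓡 4) ∞ N]

/-! A linear relation at one point propagates. If `a φ(x) + b ψ(x) = 0`, then `χ = a φ + b ψ` is
parallel and vanishes at `x`, hence everywhere (`eq_zero_of_isParallel`). The linear maps `P₊` and
`P₋` carry `χ = 0` to the same relation between the projected spinors on the chosen boundary
component, and independence there forces `a = b = 0`.

For the propagation, restrict `χ` to a smooth curve inside one frame domain: its component solves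
`u' = -A u`, so Grönwall's inequality keeps it zero as soon as `A` is bounded
(`component_eq_zero_of_curve`). Chart segments reach all nearby points, so the zero set is open; it
is closed by continuity, and `M` is connected.

Boundedness of `A` comes from Koszul's formula, which in an orthonormal frame expresses the
connection through Lie brackets of smooth fields, hence through continuous functions. -/

theorem eps_mul_eps_self (α : Fin 4) : eps α * eps α = 1 := by
  fin_cases α <;> simp [eps]

/-- The metric of two smooth vector fields along a map is smooth. -/
theorem Spacetime.contMDiffWithinAt_metric (g : Spacetime N)
    {E' : Type*} [NormedAddCommGroup E'] [NormedSpace ℝ E'] {H' : Type*} [TopologicalSpace H']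
    {J : ModelWithCorners ℝ E' H'} {P : Type*} [TopologicalSpace P] [ChartedSpace H' P]
    {n : ℕ∞} {b : P → N} {v w : ∀ p, TangentSpace (𝓡 4) (b p)} {s : Set P} {p : P}
    (hv : ContMDiffWithinAt J ((𝓡 4).prod 𝓘(ℝ, EuclideanSpace ℝ (Fin 4))) n
      (fun p => Bundle.TotalSpace.mk' (EuclideanSpace ℝ (Fin 4)) (b p) (v p)) s p)
    (hw : ContMDiffWithinAt J ((𝓡 4).prod 𝓘(ℝ, EuclideanSpace ℝ (Fin 4))) n
      (fun p => Bundle.TotalSpace.mk' (EuclideanSpace ℝ (Fin 4)) (b p) (w p)) s p) :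
    ContMDiffWithinAt J 𝓘(ℝ, ℝ) n (fun p => g.metric (b p) (v p) (w p)) s p := by
  have hb : ContMDiffWithinAt J (𝓡 4) n b s p := by
    simp only [Bundle.contMDiffWithinAt_totalSpace] at hv
    exact hv.1
  have : ContMDiffWithinAt J ((𝓡 4).prod 𝓘(ℝ)) n
      (fun m ↦ Bundle.TotalSpace.mk' ℝ (E := Bundle.Trivial N ℝ) (b m)
        (g.metric (b m) (v m) (w m))) s p := by
    apply ContMDiffWithinAt.clm_bundle_apply₂ (F₁ := EuclideanSpace ℝ (Fin 4))
      (F₂ := EuclideanSpace ℝ (Fin 4))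
    · exact ContMDiffAt.comp_contMDiffWithinAt p
        (g.contMDiff_metric.contMDiffAt.of_le (by exact_mod_cast le_top)) hb
    · exact hv
    · exact hw
  simp only [Bundle.contMDiffWithinAt_totalSpace] at this
  exact this.2

/-- An orthonormal frame spans: every tangent vector is recovered from its coordinates. -/
theorem sum_frameCoord_smul (g : Spacetime N) {y : N} (e : Fin 4 → TangentSpace (𝓡 4) y)
    (he : ∀ α β, g.metric y (e α) (e β) = if α = β then eps α else 0)
    (v : TangentSpace (𝓡 4) y) : ∑ α, frameCoord g e v α • e α = v := by
  -- Recovering the coefficients gives independence; spanning then follows by counting dimensions.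
  have coord (c : Fin 4 → ℝ) : frameCoord g e (∑ α, c α • e α) = c := by
    funext β
    simp only [frameCoord, map_sum, map_smul, he, smul_eq_mul, mul_ite, mul_zero,
      Finset.sum_ite_eq, Finset.mem_univ, if_true]
    linear_combination c β * eps_mul_eps_self β
  have hli : LinearIndependent ℝ e := by
    rw [Fintype.linearIndependent_iff]
    intro c hc α
    rw [← coord c, hc]
    simp [frameCoord]
  have hspan : Submodule.span ℝ (range e) = ⊤ := by
    apply hli.span_eq_top_of_card_eq_finrank
    change _ = Module.finrank ℝ (EuclideanSpace ℝ (Fin 4))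
    simp
  have hv : v ∈ Submodule.span ℝ (range e) := hspan ▸ Submodule.mem_top
  obtain ⟨c, rfl⟩ := (Submodule.mem_span_range_iff_exists_fun ℝ).1 hv
  rw [coord]

end Frames

/-! ### Continuity of the spin connection coefficients -/

namespace SpinStructure

variable {N : Type*} [TopologicalSpace N] [ChartedSpace (EuclideanSpace ℝ (Fin 4)) N]
  [IsManifold (𝓡 4) ∞ N] {g : Spacetime N} {K : Set N} (S : SpinStructure g K)

theorem contMDiffAt_frame (i : S.Idx) (α : Fin 4) {y : N} (hy : y ∈ S.dom i) :
    ContMDiffAt (𝓡 4) ((𝓡 4).prod 𝓘(ℝ, EuclideanSpace ℝ (Fin 4))) ∞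
      (fun y => Bundle.TotalSpace.mk' (EuclideanSpace ℝ (Fin 4)) y (S.frame i α y)) y :=
  (S.contMDiffOn_frame i α).contMDiffAt ((S.isOpen_dom i).mem_nhds hy)

/-- The structure functions `g([e_α, e_β], e_δ)` of a local frame. -/
noncomputable def structureFun (i : S.Idx) (α β δ : Fin 4) (y : N) : ℝ :=
  g.metric y (VectorField.mlieBracket (𝓡 4) (S.frame i α) (S.frame i β) y) (S.frame i δ y)

theorem continuousOn_structureFun (i : S.Idx) (α β δ : Fin 4) :
    ContinuousOn (S.structureFun i α β δ) (S.dom i) := by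
  intro y hy
  have : IsManifold (𝓡 4) (minSmoothness ℝ 2) N := by
    rw [minSmoothness_of_isRCLikeNormedField]
    infer_instance
  have : IsManifold (𝓡 4) ((1 : ℕ∞) + 1) N := IsManifold.of_le (n := ∞) (by exact_mod_cast le_top)
  -- The bracket costs one derivative, so `C¹` frames give a continuous bracket.
  have h := ContMDiffAt.mlieBracket_vectorField (n := 1) (m := 0) (I := 𝓡 4)
    ((S.contMDiffAt_frame i α hy).of_le (by exact_mod_cast le_top))
    ((S.contMDiffAt_frame i β hy).of_le (by exact_mod_cast le_top))
    (by simp)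
  exact (g.contMDiffWithinAt_metric (n := 0) (b := fun y => y) h.contMDiffWithinAt
    ((S.contMDiffAt_frame i δ hy).of_le (by simp)).contMDiffWithinAt).continuousWithinAt

/-- Koszul's formula in a local orthonormal frame. -/
theorem metric_frame_connection {D : Connection N} (hD : g.IsLeviCivita D) (i : S.Idx)
    (α β δ : Fin 4) {y : N} (hy : y ∈ S.dom i) :
    g.metric y (D (S.frame i β) y (S.frame i α y)) (S.frame i δ y) =
      (S.structureFun i α β δ y - S.structureFun i β δ α y + S.structureFun i δ α β y) / 2 := by
  have hdiff (α : Fin 4) := (S.contMDiffAt_frame i α hy).mdifferentiableAt (by simp)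
  -- Differentiate `g(e_β, e_δ)`, which is constant near `y`.
  have hskew (α β δ : Fin 4) :
      g.metric y (D (S.frame i β) y (S.frame i α y)) (S.frame i δ y) +
        g.metric y (D (S.frame i δ) y (S.frame i α y)) (S.frame i β y) = 0 := by
    have h := hD.metric y _ _ (hdiff β) (hdiff δ) (S.frame i α y)
    have hconst : (fun z => g.metric z (S.frame i β z) (S.frame i δ z)) =ᶠ[nhds y]
        fun _ => if β = δ then eps β else 0 := by
      filter_upwards [(S.isOpen_dom i).mem_nhds hy] with z hz using S.orthonormal i z hz β δ
    rw [hconst.mfderiv_eq, mfderiv_const] at h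
    rw [g.symm y (D (S.frame i δ) y (S.frame i α y))]
    exact h.symm.trans rfl
  have htors (α β δ : Fin 4) : S.structureFun i α β δ y =
      g.metric y (D (S.frame i β) y (S.frame i α y)) (S.frame i δ y) -
        g.metric y (D (S.frame i α) y (S.frame i β y)) (S.frame i δ y) := by
    rw [structureFun, ← D.torsion_eq_zero_iff.1 hD.torsion_free (hdiff α) (hdiff β), map_sub]
    rfl
  rw [htors α β δ, htors β δ α, htors δ α β]
  -- With `Γ_αβδ = g(∇̃_{e_α} e_β, e_δ)`, each bracket term is a difference of two `Γ`s; skewness in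
  -- the last two indices leaves `2 Γ_αβδ`.
  linear_combination (hskew β δ α + hskew α β δ - hskew δ α β) / 2

/-- The coefficients `¼ ∑ ε_α ε_β g(∇̃_{e_κ} e_α, e_β) γ_α γ_β` of the spin connection. -/
noncomputable def connCoeff (i : S.Idx) (κ : Fin 4) (y : N) : Matrix (Fin 4) (Fin 4) ℂ :=
  (1 / 4 : ℝ) • ∑ α, ∑ β, (eps α * eps β *
    ((S.structureFun i κ α β y - S.structureFun i α β κ y + S.structureFun i β κ α y) / 2)) •
      (gamma α * gamma β)

theorem continuousOn_connCoeff (i : S.Idx) (κ : Fin 4) :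
    ContinuousOn (S.connCoeff i κ) (S.dom i) := by
  have h := S.continuousOn_structureFun i
  unfold connCoeff
  fun_prop

/-- Linearity in `v` separates the direction from coefficients that depend on the point only and are
continuous by Koszul's formula. -/
theorem connMatrix_eq_sum {D : Connection N} (hD : g.IsLeviCivita D) (i : S.Idx) {y : N}
    (hy : y ∈ S.dom i) (v : TangentSpace (𝓡 4) y) :
    S.connMatrix D i v =
      ∑ κ, frameCoord g (fun α => S.frame i α y) v κ • S.connCoeff i κ y := by
  conv_lhs => rw [← sum_frameCoord_smul g _ (S.orthonormal i y hy) v]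
  simp only [connMatrix, connCoeff, Finset.smul_sum]
  symm
  rw [Finset.sum_comm]
  refine Finset.sum_congr rfl fun α _ => ?_
  rw [Finset.sum_comm]
  refine Finset.sum_congr rfl fun β _ => ?_
  simp only [smul_smul]
  rw [← Finset.sum_smul]
  simp only [map_sum, map_smul, sum_apply, smul_apply, S.metric_frame_connection hD i _ _ _ hy,
    smul_eq_mul, Finset.mul_sum]
  congr 1
  exact Finset.sum_congr rfl fun κ _ => by ring

end SpinStructure

/-! ### Velocities of curves -/

section Velocity

variable {N : Type*} [TopologicalSpace N] [ChartedSpace (EuclideanSpace ℝ (Fin 4)) N]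
  [IsManifold (𝓡 4) ∞ N]

/-- Order `0` expresses continuity of the velocity as a curve in the tangent bundle; derivatives
within `s` allow for the endpoints of an interval. -/
theorem contMDiffWithinAt_velocity {c : ℝ → N} {s : Set ℝ}
    (hc : ContMDiffOn 𝓘(ℝ, ℝ) (𝓡 4) ∞ c s) (hs : UniqueDiffOn ℝ s) {t : ℝ} (ht : t ∈ s) :
    ContMDiffWithinAt 𝓘(ℝ, ℝ) ((𝓡 4).prod 𝓘(ℝ, EuclideanSpace ℝ (Fin 4))) 0
      (fun t => Bundle.TotalSpace.mk' (EuclideanSpace ℝ (Fin 4)) (E := TangentSpace (𝓡 4)) (c t)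
        (mfderivWithin 𝓘(ℝ, ℝ) (𝓡 4) c s t (1 : ℝ))) s t := by
  refine ContMDiffWithinAt.clm_apply_of_inCoordinates (IB₁ := 𝓘(ℝ, ℝ)) (F₁ := ℝ)
    (E₁ := TangentSpace 𝓘(ℝ, ℝ)) (E₂ := TangentSpace (𝓡 4))
    (b₁ := fun t => t) (b₂ := c) (v := fun _ => (1 : ℝ))
    (ϕ := fun t => mfderivWithin 𝓘(ℝ, ℝ) (𝓡 4) c s t) ?_ ?_ ((hc t ht).of_le (by simp))
  · exact (hc t ht).mfderivWithin_const (by simp) ht hs.uniqueMDiffOn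
  · exact contMDiffWithinAt_vectorSpace_iff_contDiffWithinAt.2 contDiffWithinAt_const

end Velocity

/-! ### Propagation of zeros of parallel spinors -/

namespace SpacelikeHypersurface

variable {N : Type*} [TopologicalSpace N] [ChartedSpace (EuclideanSpace ℝ (Fin 4)) N]
  [IsManifold (𝓡 4) ∞ N] {M : Type*} [TopologicalSpace M] [ChartedSpace (EuclideanHalfSpace 3) M]
  [IsManifold (𝓡∂ 3) ∞ M] {g : Spacetime N} (F : SpacelikeHypersurface g M)
  {S : SpinStructure g (range F.emb)}

theorem isOpen_preimage_dom (i : S.Idx) : IsOpen (F.emb ⁻¹' S.dom i) :=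
  (S.isOpen_dom i).preimage F.contMDiff_emb.continuous

/-- The velocity in the spacetime of a curve in the hypersurface. -/
theorem push_velocity {c : ℝ → M} {s : Set ℝ} (hc : ContMDiffOn 𝓘(ℝ, ℝ) (𝓡∂ 3) ∞ c s)
    (hs : UniqueDiffOn ℝ s) {t : ℝ} (ht : t ∈ s) :
    F.push (mfderivWithin 𝓘(ℝ, ℝ) (𝓡∂ 3) c s t (1 : ℝ)) =
      mfderivWithin 𝓘(ℝ, ℝ) (𝓡 4) (F.emb ∘ c) s t (1 : ℝ) := by
  rw [mfderiv_comp_mfderivWithin t ((F.contMDiff_emb (c t)).mdifferentiableAt (by simp))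
    ((hc t ht).mdifferentiableWithinAt (by simp)) (hs.uniqueMDiffOn t ht)]
  rfl

/-- The matrix of the spin connection is continuous along a smooth curve of the hypersurface. -/
theorem continuousOn_connMatrix_velocity {D : Connection N} (hD : g.IsLeviCivita D) (i : S.Idx)
    {c : ℝ → M} {s : Set ℝ} (hc : ContMDiffOn 𝓘(ℝ, ℝ) (𝓡∂ 3) ∞ c s)
    (hs : UniqueDiffOn ℝ s) (hcs : MapsTo c s (F.emb ⁻¹' S.dom i)) :
    ContinuousOn (fun t => S.connMatrix D i
      (F.push (mfderivWithin 𝓘(ℝ, ℝ) (𝓡∂ 3) c s t (1 : ℝ)))) s := by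
  have hFc : ContMDiffOn 𝓘(ℝ, ℝ) (𝓡 4) ∞ (F.emb ∘ c) s := F.contMDiff_emb.comp_contMDiffOn hc
  have hcoord (κ : Fin 4) : ContinuousOn (fun t => g.metric (F.emb (c t)) (S.frame i κ (F.emb (c t)))
      (mfderivWithin 𝓘(ℝ, ℝ) (𝓡 4) (F.emb ∘ c) s t (1 : ℝ))) s := fun t ht =>
    (g.contMDiffWithinAt_metric (n := 0) (b := F.emb ∘ c)
      (((S.contMDiffAt_frame i κ (hcs ht)).of_le (by simp)).comp_contMDiffWithinAt t
        ((hFc t ht).of_le (by simp)))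
      (contMDiffWithinAt_velocity hFc hs ht)).continuousWithinAt
  have hcoeff (κ : Fin 4) : ContinuousOn (fun t => S.connCoeff i κ (F.emb (c t))) s :=
    (S.continuousOn_connCoeff i κ).comp hFc.continuousOn hcs
  have hsum : ContinuousOn (fun t => ∑ κ, (eps κ * g.metric (F.emb (c t))
      (S.frame i κ (F.emb (c t))) (mfderivWithin 𝓘(ℝ, ℝ) (𝓡 4) (F.emb ∘ c) s t (1 : ℝ))) •
        S.connCoeff i κ (F.emb (c t))) s := by
    fun_prop
  refine hsum.congr fun t ht => ?_
  rw [S.connMatrix_eq_sum hD i (hcs ht), F.push_velocity hc hs ht]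
  rfl

/-- A parallel spinor field which vanishes at the start of a smooth curve vanishes at its end. -/
theorem component_eq_zero_of_curve {D : Connection N} (hD : g.IsLeviCivita D)
    {χ : F.SpinorField S} (hχ : F.IsSmooth χ) (hχ' : F.IsParallel D χ) (i : S.Idx)
    {c : ℝ → M} (hc : ContMDiffOn 𝓘(ℝ, ℝ) (𝓡∂ 3) ∞ c (Icc 0 1))
    (hcs : MapsTo c (Icc 0 1) (F.emb ⁻¹' S.dom i)) (h0 : F.component χ i (c 0) = 0) :
    F.component χ i (c 1) = 0 := by
  have hs : UniqueDiffOn ℝ (Icc (0 : ℝ) 1) := uniqueDiffOn_Icc one_pos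
  set A : ℝ → Matrix (Fin 4) (Fin 4) ℂ := fun t => S.connMatrix D i
    (F.push (mfderivWithin 𝓘(ℝ, ℝ) (𝓡∂ 3) c (Icc 0 1) t (1 : ℝ))) with hA
  have hAc : ContinuousOn A (Icc 0 1) := F.continuousOn_connMatrix_velocity hD i hc hs hcs
  -- By the chain rule, parallelism along the curve is the linear equation `u' = -A u`.
  have hderiv (t : ℝ) (ht : t ∈ Icc (0 : ℝ) 1) : HasDerivWithinAt (F.component χ i ∘ c)
      (-(A t *ᵥ F.component χ i (c t))) (Icc 0 1) t := by
    have h1 : MDifferentiableAt (𝓡∂ 3) 𝓘(ℝ, Fin 4 → ℂ) (F.component χ i) (c t) :=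
      ((hχ i).contMDiffAt ((F.isOpen_preimage_dom i).mem_nhds (hcs ht))).mdifferentiableAt (by simp)
    have h2 := (hc t ht).mdifferentiableWithinAt (n := ∞) (by simp)
    let L : ℝ →L[ℝ] Fin 4 → ℂ := mfderiv (𝓡∂ 3) 𝓘(ℝ, Fin 4 → ℂ) (F.component χ i) (c t) ∘L
      mfderivWithin 𝓘(ℝ, ℝ) (𝓡∂ 3) c (Icc 0 1) t
    have h3 : HasFDerivWithinAt (F.component χ i ∘ c) L (Icc 0 1) t :=
      (h1.hasMFDerivAt.comp_hasMFDerivWithinAt t h2.hasMFDerivWithinAt).hasFDerivWithinAt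
    have h4 := hχ' (c t) i (hcs ht) (mfderivWithin 𝓘(ℝ, ℝ) (𝓡∂ 3) c (Icc 0 1) t (1 : ℝ))
    exact h3.hasDerivWithinAt.congr_deriv (eq_neg_of_add_eq_zero_left h4)
  -- Matrices are read as operators on `ℂ⁴`, so that compactness yields an operator norm bound `C`,
  -- the Grönwall constant.
  let Φ : Matrix (Fin 4) (Fin 4) ℂ →L[ℂ] ((Fin 4 → ℂ) →L[ℂ] (Fin 4 → ℂ)) :=
    LinearMap.toContinuousLinearMap
      (LinearMap.toContinuousLinearMap.toLinearMap ∘ₗ Matrix.toLin'.toLinearMap)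
  obtain ⟨C, hC⟩ := isCompact_Icc.exists_bound_of_continuousOn
    (Φ.continuous.comp_continuousOn hAc)
  refine eq_zero_of_abs_deriv_le_mul_abs_self_of_eq_zero_right (f := F.component χ i ∘ c)
    (a := 0) (b := 1) (K := C) (fun t ht => (hderiv t ht).continuousWithinAt)
    (fun t ht => (hderiv t (Ico_subset_Icc_self ht)).mono_of_mem_nhdsWithin
      (Icc_mem_nhdsGE_of_mem ht)) h0 (fun t ht => ?_) 1 (right_mem_Icc.2 zero_le_one)
  rw [norm_neg]
  exact (Φ (A t)).le_of_opNorm_le (hC t (Ico_subset_Icc_self ht)) _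

/-- Nearby points are joined by curves which are segments in a chart. -/
theorem eventually_exists_curve {U : Set M} (hU : IsOpen U) {x : M} (hx : x ∈ U) :
    ∀ᶠ y in nhds x, ∃ c : ℝ → M, ContMDiffOn 𝓘(ℝ, ℝ) (𝓡∂ 3) ∞ c (Icc 0 1) ∧
      MapsTo c (Icc 0 1) U ∧ c 0 = x ∧ c 1 = y := by
  set e := extChartAt (𝓡∂ 3) x
  have hpre : e.target ∩ e.symm ⁻¹' U ∈ nhdsWithin (e x) (range (𝓡∂ 3)) := by
    refine Filter.inter_mem (extChartAt_target_mem_nhdsWithin x) ?_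
    have := continuousAt_extChartAt_symm (I := 𝓡∂ 3) x
    exact mem_nhdsWithin_of_mem_nhds (this.preimage_mem_nhds
      (by rw [extChartAt_to_inv]; exact hU.mem_nhds hx))
  obtain ⟨r, hr, hball⟩ := Metric.mem_nhdsWithin_iff.1 hpre
  have hsrc := extChartAt_source_mem_nhds (I := 𝓡∂ 3) x
  have hb := (continuousAt_extChartAt (I := 𝓡∂ 3) x).preimage_mem_nhds (Metric.ball_mem_nhds _ hr)
  filter_upwards [hsrc, hb] with y hy hyr
  have hrange (z : M) (hz : z ∈ e.source) : e z ∈ range (𝓡∂ 3) :=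
    extChartAt_target_subset_range x (e.map_source hz)
  -- The half-space is convex, so the segment stays in the chart image even when `x` is a boundary
  -- point.
  have hconv : Convex ℝ (Metric.ball (e x) r ∩ range (𝓡∂ 3)) :=
    (convex_ball _ _).inter (𝓡∂ 3).convex_range
  have hxs : x ∈ e.source := mem_extChartAt_source x
  have hmap : MapsTo (AffineMap.lineMap (k := ℝ) (e x) (e y)) (Icc 0 1)
      (e.target ∩ e.symm ⁻¹' U) := fun t ht =>
    hball (hconv.lineMap_mem ⟨Metric.mem_ball_self hr, hrange x hxs⟩ ⟨hyr, hrange y hy⟩ ht)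
  refine ⟨e.symm ∘ AffineMap.lineMap (k := ℝ) (e x) (e y), ?_, fun t ht => (hmap ht).2, ?_, ?_⟩
  · refine (contMDiffOn_extChartAt_symm x).comp (t := e.target) ?_ fun t ht => (hmap ht).1
    exact (ContinuousAffineMap.lineMap (R := ℝ) (e x) (e y)).contDiff.contMDiff.contMDiffOn
  · simp [e.left_inv hxs]
  · simp [e.left_inv hy]

/-- The transition maps are linear, so one vanishing component makes all of them vanish. -/
theorem eq_zero_iff_component {χ : F.SpinorField S} {i : S.Idx} {x : M} (hx : F.emb x ∈ S.dom i) :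
    χ x = 0 ↔ F.component χ i x = 0 := by
  constructor
  · intro h
    simp [component, hx, h]
  · intro h
    rw [component, dif_pos hx] at h
    refine Subtype.ext (funext fun j => ?_)
    rw [(χ x).2 j ⟨i, hx⟩, h]
    simp

/-- A parallel spinor field on a connected hypersurface which vanishes at one point vanishes
identically. -/
theorem eq_zero_of_isParallel [ConnectedSpace M] {D : Connection N} (hD : g.IsLeviCivita D)
    {χ : F.SpinorField S} (hχ : F.IsSmooth χ) (hχ' : F.IsParallel D χ) {x₀ : M} (h0 : χ x₀ = 0)
    (x : M) : χ x = 0 := by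
  have hdom (y : M) : ∃ i, F.emb y ∈ S.dom i := mem_iUnion.1 (S.covers (mem_range_self y))
  have hopen : IsOpen {y | χ y = 0} := by
    refine isOpen_iff_mem_nhds.2 fun y hy => ?_
    obtain ⟨i, hi⟩ := hdom y
    filter_upwards [eventually_exists_curve (F.isOpen_preimage_dom i) hi]
    rintro z ⟨c, hc, hcs, rfl, rfl⟩
    exact (F.eq_zero_iff_component (hcs (right_mem_Icc.2 zero_le_one))).2
      (F.component_eq_zero_of_curve hD hχ hχ' i hc hcs ((F.eq_zero_iff_component hi).1 hy))
  have hopen' : IsOpen {y | χ y ≠ 0} := by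
    refine isOpen_iff_mem_nhds.2 fun y hy => ?_
    obtain ⟨i, hi⟩ := hdom y
    have hnhds := (F.isOpen_preimage_dom i).mem_nhds hi
    filter_upwards [hnhds, ((hχ i).continuousOn.continuousAt hnhds).eventually_ne
      (mt (F.eq_zero_iff_component hi).2 hy)] with z hz hz'
    exact mt (F.eq_zero_iff_component hz).1 hz'
  have hclopen : IsClopen {y | χ y = 0} := ⟨⟨hopen'⟩, hopen⟩
  exact (hclopen.eq_univ ⟨x₀, h0⟩).ge (mem_univ x)

/-! ### Complex linear combinations of parallel spinors -/

theorem component_smul_add_smul (φ ψ : F.SpinorField S) (a b : ℂ) (i : S.Idx) :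
    F.component (fun x => a • φ x + b • ψ x) i =
      a • F.component φ i + b • F.component ψ i := by
  funext x
  by_cases h : F.emb x ∈ S.dom i <;> simp [component, h]

theorem IsSmooth.smul_add_smul {φ ψ : F.SpinorField S} (hφ : F.IsSmooth φ) (hψ : F.IsSmooth ψ)
    (a b : ℂ) : F.IsSmooth (fun x => a • φ x + b • ψ x : F.SpinorField S) := by
  intro i
  rw [component_smul_add_smul]
  have hsmul (a : ℂ) : ContDiff ℝ ∞ (fun v : Fin 4 → ℂ => a • v) := contDiff_const_smul a
  exact ((hsmul a).contMDiff.comp_contMDiffOn (hφ i)).add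
    ((hsmul b).contMDiff.comp_contMDiffOn (hψ i))

theorem IsParallel.smul_add_smul {D : Connection N} {φ ψ : F.SpinorField S} (hφ : F.IsSmooth φ)
    (hψ : F.IsSmooth ψ) (hφ' : F.IsParallel D φ) (hψ' : F.IsParallel D ψ) (a b : ℂ) :
    F.IsParallel D (fun x => a • φ x + b • ψ x : F.SpinorField S) := by
  intro x i hx X
  have hdiff {χ : F.SpinorField S} (hχ : F.IsSmooth χ) :
      HasMFDerivAt (𝓡∂ 3) 𝓘(ℝ, Fin 4 → ℂ) (F.component χ i) x _ :=
    (((hχ i).contMDiffAt ((F.isOpen_preimage_dom i).mem_nhds hx)).mdifferentiableAt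
      (by simp)).hasMFDerivAt
  -- Derivatives are real, scalars complex: multiplication by `a` enters the chain rule as a
  -- real-linear map.
  let m (a : ℂ) : (Fin 4 → ℂ) →L[ℝ] (Fin 4 → ℂ) := a • ContinuousLinearMap.id ℝ (Fin 4 → ℂ)
  have hm (a : ℂ) {χ : F.SpinorField S} (hχ : F.IsSmooth χ) :=
    ((m a).hasFDerivAt (x := F.component χ i x)).hasMFDerivAt.comp x (hdiff hχ)
  have h := (hm a hφ).add (hm b hψ)
  have hcomp : F.component (fun x => a • φ x + b • ψ x) i =
      m a ∘ F.component φ i + m b ∘ F.component ψ i :=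
    F.component_smul_add_smul φ ψ a b i
  rw [← hcomp] at h
  have h1 : a • F.spinDeriv D φ i x X + b • F.spinDeriv D ψ i x X = 0 := by
    rw [hφ' x i hx X, hψ' x i hx X]
    simp
  rw [← h1]
  simp only [spinDeriv, h.mfderiv, component_smul_add_smul, Pi.add_apply, Pi.smul_apply,
    Matrix.mulVec_add, Matrix.mulVec_smul]
  have hadd (p q r s : Fin 4 → ℂ) :
      (a • p + b • q) + (a • r + b • s) = a • (p + r) + b • (q + s) := by module
  exact hadd _ _ _ _

end SpacelikeHypersurface

end HypersurfaceSpinor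

theorem proposition2
    {N : Type*} [TopologicalSpace N] [T2Space N] [SecondCountableTopology N]
    [ChartedSpace (EuclideanSpace ℝ (Fin 4)) N] [IsManifold (𝓡 4) ∞ N]
    {M : Type*} [TopologicalSpace M] [T2Space M] [SecondCountableTopology M]
    [ChartedSpace (EuclideanHalfSpace 3) M] [IsManifold (𝓡∂ 3) ∞ M] [ConnectedSpace M]
    (g : HypersurfaceSpinor.Spacetime N)
    (F : HypersurfaceSpinor.SpacelikeHypersurface g M)
    (S : HypersurfaceSpinor.SpinStructure g (range F.emb))
    (D : HypersurfaceSpinor.Connection N) (hD : g.IsLeviCivita D)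
    (e₀ : ∀ x : M, TangentSpace (𝓡 4) (F.emb x)) (he₀ : ∀ x, F.IsFutureUnitNormal x (e₀ x))
    (eᵣ : ∀ x : M, TangentSpace (𝓡∂ 3) x)
    (heᵣ : ∀ x ∈ (𝓡∂ 3).boundary M, F.IsOutwardUnitNormal x (eᵣ x))
    {l : ℕ} (B : Fin l → Set M) (hB : HypersurfaceSpinor.AreBoundarySpheres B)
    (φ ψ : F.SpinorField S) (hφ : F.IsSmooth φ) (hψ : F.IsSmooth ψ)
    (hφ' : F.IsParallel D φ) (hψ' : F.IsParallel D ψ)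
    (k : Fin l)
    (hind :
      LinearIndependent ℂ
        ![fun x : B k => F.projPlus S (e₀ x) (eᵣ x) (φ x),
          fun x : B k => F.projPlus S (e₀ x) (eᵣ x) (ψ x)] ∨
      LinearIndependent ℂ
        ![fun x : B k => F.projMinus S (e₀ x) (eᵣ x) (φ x),
          fun x : B k => F.projMinus S (e₀ x) (eᵣ x) (ψ x)]) :
    ∀ x : M, LinearIndependent ℂ ![φ x, ψ x] := by
  intro x
  rw [LinearIndependent.pair_iff]
  intro a b hab
  have hzero := F.eq_zero_of_isParallel hD (hφ.smul_add_smul F hψ a b)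
    (hφ'.smul_add_smul F hφ hψ hψ' a b) hab
  -- By linearity, the projected combination at `y` is the projection of `a φ(y) + b ψ(y) = 0`.
  rcases hind with h | h <;> refine LinearIndependent.pair_iff.1 h a b (funext fun y => ?_) <;>
    simp only [Pi.add_apply, Pi.smul_apply, Pi.zero_apply, ← map_smul, ← map_add] <;>
    exact (congrArg _ (hzero y)).trans (map_zero _)
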